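/- Let $\mu=N(0,1)$ be the standard Gaussian measure on $\mathbb R$ and let $H_\nu$, $\nu\in\mathbb N_0$, be the Hermite polynomials orthonormal in $L^2_\mu=L^2(\mathbb R,\mu)$, i.e. $H_\nu = He_\nu/\sqrt{\nu!}$ with $He_\nu$ the monic (probabilists') Hermite polynomial of degree $\nu$. For $i\in\mathbb N_0$ let $U_i$ be the Lagrange interpolation operator based on the $i+1$ zeros of $H_{i+1}$, that is, $U_i f=\sum_{k=0}^{i} f(\xi_k^{(i)})\,L_k^{(i)}$, where $\xi_0^{(i)},\dots,\xi_i^{(i)}$ are the zeros of $H_{i+1}$ and $L_k^{(i)}$ the associated Lagrange fundamental polynomials. Put $\Delta_i=U_i-U_{i-1}$ for $i\ge 0$, with $U_{-1}=0$. Let $c=1.086435$ (the constant appearing in Cramér's inequality for Hermite functions). Then for every integer $\nu\ge 1$ \[ \|U_iH_\nu\|_{L^2_\mu}^2\le c^2\,\mathrm e\,\sqrt{2\nu-1}\qquad\text{for all } i\in\mathbb N_0 . \] Moreover, with $K=2c\sqrt{\mathrm e}$ one has $K>1$ and \[ \|\Delta_iH_\nu\|_{L^2_\mu}\le 1+K\nu\qquad\text{for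 all } i,\nu\in\mathbb N_0 . \] -/

import Mathlib

noncomputable section

/-- The univariate Hermite orthonormal polynomial of degree `ν` with respect to the standard
Gaussian measure `N(0,1)`, i.e. `He_ν / √(ν!)` with `He_ν` the (monic) probabilists' Hermite
polynomial. -/
def hermiteON (ν : ℕ) : Polynomial ℝ :=
  Polynomial.C (√(ν.factorial : ℝ))⁻¹ * (Polynomial.hermite ν).map (Int.castRingHom ℝ)

/-- The Gauss-Hermite nodes `Ξ^(i)`: the real zeros of the `(i+1)`-th Hermite polynomial. -/
def gaussHermiteNodes (i : ℕ) : Finset ℝ :=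
  (hermiteON (i + 1)).roots.toFinset

/-- The Lagrange interpolation operator `U_i` at the zeros of the `(i+1)`-th Hermite polynomial:
`U_i f = ∑_{ξ ∈ Ξ^(i)} f(ξ) L_ξ`, with `L_ξ` the Lagrange fundamental polynomials. -/
def gaussHermiteInterp (i : ℕ) : (ℝ → ℝ) →ₗ[ℝ] Polynomial ℝ :=
  Lagrange.interpolate (gaussHermiteNodes i) id

/-- The detail operators `Δ_i = U_i - U_{i-1}`, with `U_{-1} = 0`. -/
def gaussHermiteDetail : ℕ → (ℝ → ℝ) →ₗ[ℝ] Polynomial ℝ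
  | 0 => gaussHermiteInterp 0
  | i + 1 => gaussHermiteInterp (i + 1) - gaussHermiteInterp i

/-- The norm of a polynomial in `L²_μ`, `μ = N(0,1)` on `ℝ`, as an extended nonnegative real. -/
def gaussL2Norm (p : Polynomial ℝ) : ENNReal :=
  MeasureTheory.eLpNorm (fun ξ : ℝ => p.eval ξ) 2 (ProbabilityTheory.gaussianReal 0 1)

/-- The numerical constant in Cramér's inequality for Hermite functions. -/
def cramerConst : ℝ := 1.086435

end

open Polynomial MeasureTheory ProbabilityTheory

/-! On polynomials, `U_i` is the remainder modulo `He_{i+1}`. If `ν ≤ i` then `U_i H_ν = H_ν` has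
norm one. Otherwise Gauss quadrature, exact in degree `2i+1` with nonnegative weights `w_x`, gives
`‖U_i H_ν‖² = ∑ w_x H_ν(x)²`, and three estimates finish. (1) A Cramér type bound `H_ν(x)² ≤ 1.34
exp(x²/2)` (`hermiteSq_le`), from Cauchy's estimate for the diagonal Mehler kernel. (2) Quadrature
never overestimates a monomial (`sum_gaussHermiteWeight_mul_pow_le`), so by Taylor expansion `∑ w_x
exp(a x²) ≤ (1-2a)^(-1/2)` for `0 ≤ a < 1/2`. (3) The nodes satisfy `x² < 4i+2 ≤ 4ν-2`, so raising
`a` to the critical `1/2` costs only a factor `√e`. The product is `1.34 √2 √e √(2ν-1)`; since `√2 <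
√e`, there is room for `1.34` in place of `c²`. The bound on `Δ_i` is the triangle inequality with
`(2ν-1)^(1/4) ≤ ν`. -/

/-- The probabilists' Hermite polynomial with real coefficients. -/
noncomputable def hermiteReal (n : ℕ) : ℝ[X] := (hermite n).map (Int.castRingHom ℝ)

/-! ### Derivative and three-term recurrence of the Hermite polynomials. -/

theorem derivative_hermite_succ (n : ℕ) :
    derivative (hermite (n + 1)) = ((n : ℤ[X]) + 1) * hermite n := by
  induction n with
  | zero => simp
  | succ n ih =>
    rw [hermite_succ (n + 1), derivative_sub, derivative_mul, ih, derivative_X, derivative_mul,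
      hermite_succ n]
    simp
    ring

theorem hermite_add_two (n : ℕ) :
    hermite (n + 2) = X * hermite (n + 1) - ((n : ℤ[X]) + 1) * hermite n := by
  rw [hermite_succ (n + 1), derivative_hermite_succ]

theorem hermiteReal_zero : hermiteReal 0 = 1 := by simp [hermiteReal]

theorem hermiteReal_one : hermiteReal 1 = X := by simp [hermiteReal]

theorem hermiteReal_succ (n : ℕ) :
    hermiteReal (n + 1) = X * hermiteReal n - derivative (hermiteReal n) := by
  simp [hermiteReal, derivative_map]

theorem derivative_hermiteReal_succ (n : ℕ) :
    derivative (hermiteReal (n + 1)) = C ((n : ℝ) + 1) * hermiteReal n := by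
  rw [hermiteReal, derivative_map, derivative_hermite_succ]
  simp [hermiteReal]

theorem hermiteReal_add_two (n : ℕ) :
    hermiteReal (n + 2) = X * hermiteReal (n + 1) - C ((n : ℝ) + 1) * hermiteReal n := by
  rw [hermiteReal, hermite_add_two]
  simp [hermiteReal]

theorem hermiteReal_monic (n : ℕ) : (hermiteReal n).Monic := (hermite_monic n).map _

theorem natDegree_hermiteReal (n : ℕ) : (hermiteReal n).natDegree = n := by
  rw [hermiteReal, (hermite_monic n).natDegree_map, natDegree_hermite]

theorem eval_hermiteReal_add_two (n : ℕ) (x : ℝ) :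
    (hermiteReal (n + 2)).eval x =
      x * (hermiteReal (n + 1)).eval x - (n + 1) * (hermiteReal n).eval x := by
  simp [hermiteReal_add_two]

/-! ### Zeros of the Hermite polynomials: real, simple, and bounded. -/

/-- In the recurrence, `z |He_{n+1}|²` has positive imaginary part and the other term reproduces the
inductive quantity. Hence there are no zeros off the real axis. -/
theorem im_aeval_hermite_pos (z : ℂ) (hz : 0 < z.im) (n : ℕ) :
    0 < (aeval z (hermite (n + 1)) * (starRingEnd ℂ) (aeval z (hermite n))).im := by
  induction n with
  | zero => simpa using hz
  | succ n ih =>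
    have h : aeval z (hermite (n + 2)) =
        z * aeval z (hermite (n + 1)) - ((n : ℂ) + 1) * aeval z (hermite n) := by
      rw [hermite_add_two]
      simp [-hermite_succ]
    rw [h]
    generalize aeval z (hermite (n + 1)) = a at *
    generalize aeval z (hermite n) = b at *
    have hn : (0 : ℝ) < n + 1 := by positivity
    have h2 : ((z * a - ((n : ℂ) + 1) * b) * (starRingEnd ℂ) a).im =
        z.im * (a.re ^ 2 + a.im ^ 2) + (n + 1) * (a * (starRingEnd ℂ) b).im := by
      simp
      ring
    rw [h2]
    have := mul_pos hn ih
    positivity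

theorem aeval_hermite_ne_zero_of_im_pos (z : ℂ) (hz : 0 < z.im) (n : ℕ) :
    aeval z (hermite n) ≠ 0 := by
  intro h
  have := im_aeval_hermite_pos z hz n
  simp [h] at this

theorem im_eq_zero_of_aeval_hermite_eq_zero (z : ℂ) (n : ℕ) (h : aeval z (hermite n) = 0) :
    z.im = 0 := by
  rcases lt_trichotomy z.im 0 with h0 | h0 | h0
  · refine absurd ?_ (aeval_hermite_ne_zero_of_im_pos ((starRingEnd ℂ) z) (by simpa using h0) n)
    have h1 : aeval ((starRingEnd ℂ) z) (hermite n) = (starRingEnd ℂ) (aeval z (hermite n)) := by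
      simp only [aeval_def, eval₂_eq_sum_range, map_sum, map_mul, map_pow]
      simp
    rw [h1, h, map_zero]
  · exact h0
  · exact absurd h (aeval_hermite_ne_zero_of_im_pos z h0 n)

theorem hermiteReal_splits (n : ℕ) : (hermiteReal n).Splits := by
  refine Splits.of_splits_map_of_injective (i := algebraMap ℝ ℂ) (algebraMap ℝ ℂ).injective
    (IsAlgClosed.splits _) ?_
  intro z hz
  have h0 : (hermiteReal n).map (algebraMap ℝ ℂ) ≠ 0 := ((hermiteReal_monic n).map _).ne_zero
  have h1 : aeval z (hermite n) = 0 := by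
    have := (mem_roots h0).1 hz
    rw [IsRoot, hermiteReal, Polynomial.map_map, eval_map] at this
    rwa [aeval_def, Subsingleton.elim (algebraMap ℤ ℂ) ((algebraMap ℝ ℂ).comp (Int.castRingHom ℝ))]
  exact ⟨z.re, Complex.ext (by simp) (by simp [im_eq_zero_of_aeval_hermite_eq_zero z n h1])⟩

theorem eval_hermiteReal_ne_zero_of_succ_eq_zero (x : ℝ) (n : ℕ)
    (h : (hermiteReal (n + 1)).eval x = 0) : (hermiteReal n).eval x ≠ 0 := by
  induction n with
  | zero => simp [hermiteReal_zero]
  | succ n ih =>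
    intro h1
    refine ih h1 ?_
    rw [eval_hermiteReal_add_two, h1] at h
    have hn : (n : ℝ) + 1 ≠ 0 := by positivity
    simpa [hn] using h

/-- The derivative of `He_{n+1}` is `(n+1) He_n`, so a double zero would be common to two
consecutive Hermite polynomials. -/
theorem nodup_roots_hermiteReal (n : ℕ) : (hermiteReal n).roots.Nodup := by
  rcases n with _ | n
  · simp [hermiteReal_zero]
  rw [Multiset.nodup_iff_count_le_one]
  intro x
  rw [count_roots]
  by_contra! h
  have h0 := (one_lt_rootMultiplicity_iff_isRoot (hermiteReal_monic (n + 1)).ne_zero).1 h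
  have hn : (n : ℝ) + 1 ≠ 0 := by positivity
  have h1 := h0.2
  simp only [derivative_hermiteReal_succ, IsRoot, eval_mul, eval_C, mul_eq_zero, hn,
    false_or] at h1
  exact eval_hermiteReal_ne_zero_of_succ_eq_zero x n h0.1 h1

theorem gaussHermiteNodes_eq (i : ℕ) :
    gaussHermiteNodes i = (hermiteReal (i + 1)).roots.toFinset := by
  rw [gaussHermiteNodes, hermiteON, roots_C_mul]
  · rfl
  · positivity

theorem card_gaussHermiteNodes (i : ℕ) : (gaussHermiteNodes i).card = i + 1 := by
  rw [gaussHermiteNodes_eq, Multiset.toFinset_card_of_nodup (nodup_roots_hermiteReal _),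
    ← (hermiteReal_splits _).natDegree_eq_card_roots, natDegree_hermiteReal]

theorem mem_gaussHermiteNodes {i : ℕ} {x : ℝ} :
    x ∈ gaussHermiteNodes i ↔ (hermiteReal (i + 1)).eval x = 0 := by
  simp [gaussHermiteNodes_eq, (hermiteReal_monic (i + 1)).ne_zero]

/-- Outside this range the recurrence forces growth: with `s² = i + 1/2` and `|x| ≥ 2s`, each step
up to `He_{i+1}` multiplies the absolute value by at least `s`, because the subtracted term is at
most `s |He_{j+1}|`. -/
theorem sq_lt_of_mem_gaussHermiteNodes {i : ℕ} {x : ℝ} (hx : x ∈ gaussHermiteNodes i) :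
    x ^ 2 < 4 * i + 2 := by
  by_contra! h
  rw [mem_gaussHermiteNodes] at hx
  set s : ℝ := √(i + 1 / 2) with hs
  have hs2 : s ^ 2 = i + 1 / 2 := Real.sq_sqrt (by positivity)
  have hs0 : 0 < s := Real.sqrt_pos.2 (by positivity)
  have hxs : 2 * s ≤ |x| := by
    rw [← abs_of_pos (by positivity : 0 < 2 * s)]
    exact sq_le_sq.1 (by nlinarith)
  have key : ∀ j : ℕ, j ≤ i → s * |(hermiteReal j).eval x| ≤ |(hermiteReal (j + 1)).eval x| ∧
      0 < |(hermiteReal (j + 1)).eval x| := by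
    intro j
    induction j with
    | zero =>
      intro _
      simp only [hermiteReal_zero, zero_add, hermiteReal_one, eval_one, eval_X, abs_one]
      constructor <;> linarith
    | succ j ih =>
      intro hj
      obtain ⟨h1, h2⟩ := ih (by omega)
      rw [eval_hermiteReal_add_two]
      set a := (hermiteReal (j + 1)).eval x
      set b := (hermiteReal j).eval x
      have hj' : (j : ℝ) + 1 ≤ i := by exact_mod_cast hj
      have h3 : |x| * |a| - (j + 1) * |b| ≤ |x * a - (j + 1) * b| := by
        have := abs_sub_abs_le_abs_sub (x * a) ((j + 1) * b)
        rwa [abs_mul, abs_mul, abs_of_pos (by positivity : (0 : ℝ) < j + 1)] at this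
      have h4 : (j + 1) * |b| ≤ s * |a| := by
        refine le_of_mul_le_mul_left ?_ hs0
        have : (j + 1) * (s * |b|) ≤ s ^ 2 * |a| :=
          mul_le_mul (by linarith) h1 (by positivity) (by positivity)
        linarith
      have h5 : 2 * s * |a| ≤ |x| * |a| := by gcongr
      have h6 : s * |a| ≤ |x * a - (j + 1) * b| := by linarith
      exact ⟨h6, lt_of_lt_of_le (by positivity) h6⟩
  have := (key i le_rfl).2
  simp [hx] at this

/-! ### Gaussian expectation of polynomials and orthogonality. -/

theorem integrable_eval_gaussianReal (p : ℝ[X]) :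
    Integrable (fun x => p.eval x) (gaussianReal 0 1) := by
  simp_rw [eval_eq_sum_range]
  refine integrable_finsetSum _ fun k _ => Integrable.const_mul ?_ _
  exact integrable_pow_of_mem_interior_integrableExpSet (X := fun x => x) (by simp) k

/-- The expectation of a polynomial with respect to the standard Gaussian measure. -/
noncomputable def gaussMean : ℝ[X] →ₗ[ℝ] ℝ where
  toFun p := ∫ x, p.eval x ∂gaussianReal 0 1
  map_add' p q := by
    simp only [eval_add]
    exact integral_add (integrable_eval_gaussianReal p) (integrable_eval_gaussianReal q)
  map_smul' c p := by
    simp only [eval_smul, RingHom.id_apply]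
    exact integral_smul c _

theorem gaussMean_apply (p : ℝ[X]) : gaussMean p = ∫ x, p.eval x ∂gaussianReal 0 1 := rfl

theorem gaussMean_C_mul (c : ℝ) (p : ℝ[X]) : gaussMean (C c * p) = c * gaussMean p := by
  rw [← smul_eq_C_mul, map_smul, smul_eq_mul]

theorem gaussMean_one : gaussMean 1 = 1 := by simp [gaussMean_apply]

theorem gaussMean_mul_self_nonneg (p : ℝ[X]) : 0 ≤ gaussMean (p * p) := by
  rw [gaussMean_apply]
  exact integral_nonneg fun x => by simpa using mul_self_nonneg _

theorem gaussianPDFReal_zero_one (x : ℝ) :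
    gaussianPDFReal 0 1 x = (√(2 * Real.pi))⁻¹ * Real.exp (-(x ^ 2 / 2)) := by
  simp [gaussianPDFReal_def, neg_div]

theorem integrable_gaussianReal_iff {f : ℝ → ℝ} :
    Integrable f (gaussianReal 0 1) ↔ Integrable (fun x => gaussianPDFReal 0 1 x * f x) := by
  rw [gaussianReal_of_var_ne_zero _ one_ne_zero, integrable_withDensity_iff_integrable_smul'
    (measurable_gaussianPDF _ _) (ae_of_all _ fun _ => gaussianPDF_lt_top)]
  simp [toReal_gaussianPDF]

theorem hasDerivAt_gaussianPDFReal (x : ℝ) :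
    HasDerivAt (gaussianPDFReal 0 1) (-(x * gaussianPDFReal 0 1 x)) x := by
  rw [gaussianPDFReal_zero_one, show gaussianPDFReal 0 1 = _ from funext gaussianPDFReal_zero_one]
  have h : HasDerivAt (fun y : ℝ => -(y ^ 2 / 2)) (-x) x :=
    (((hasDerivAt_pow 2 x).div_const 2).neg).congr_deriv (by simp)
  exact (h.exp.const_mul _).congr_deriv (by ring)

/-- Integration by parts: the density satisfies `φ' = -xφ`. -/
theorem gaussMean_X_mul (p : ℝ[X]) : gaussMean (X * p) = gaussMean (derivative p) := by
  have hi : ∀ q : ℝ[X], Integrable (fun x => gaussianPDFReal 0 1 x * q.eval x) := fun q =>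
    integrable_gaussianReal_iff.1 (integrable_eval_gaussianReal q)
  have key := integral_mul_deriv_eq_deriv_mul_of_integrable (u := fun x => p.eval x)
    (u' := fun x => (derivative p).eval x) (v := gaussianPDFReal 0 1)
    (v' := fun x => -(x * gaussianPDFReal 0 1 x)) (fun x _ => p.hasDerivAt x)
    (fun x _ => hasDerivAt_gaussianPDFReal x) ?_ ?_ ?_
  · rw [gaussMean_apply, gaussMean_apply, integral_gaussianReal_eq_integral_smul one_ne_zero,
      integral_gaussianReal_eq_integral_smul one_ne_zero]
    rw [← neg_inj, neg_neg, ← integral_neg] at key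
    calc _ = _ := integral_congr_ae (ae_of_all _ fun x => ?_)
      _ = _ := key
      _ = _ := integral_congr_ae (ae_of_all _ fun x => ?_)
    · simp only [smul_eq_mul, eval_mul, eval_X]
      ring
    · simp only [smul_eq_mul]
      ring
  · refine (hi (X * p)).neg.congr (ae_of_all _ fun x => ?_)
    simp only [Pi.neg_apply, Pi.mul_apply, eval_mul, eval_X]
    ring
  · refine (hi (derivative p)).congr (ae_of_all _ fun x => ?_)
    simp only [Pi.mul_apply]
    ring
  · refine (hi p).congr (ae_of_all _ fun x => ?_)
    simp only [Pi.mul_apply]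
    ring

theorem gaussMean_hermiteReal_succ_mul (n : ℕ) (q : ℝ[X]) :
    gaussMean (hermiteReal (n + 1) * q) = gaussMean (hermiteReal n * derivative q) := by
  rw [hermiteReal_succ, sub_mul, map_sub, mul_assoc, gaussMean_X_mul, derivative_mul, map_add]
  ring

theorem gaussMean_hermiteReal_mul_eq_zero (n : ℕ) (q : ℝ[X]) (hq : q.natDegree ≤ n) :
    gaussMean (hermiteReal (n + 1) * q) = 0 := by
  induction n generalizing q with
  | zero => simp [gaussMean_hermiteReal_succ_mul, derivative_of_natDegree_zero (Nat.le_zero.1 hq)]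
  | succ n ih =>
    rw [gaussMean_hermiteReal_succ_mul]
    exact ih _ ((natDegree_derivative_le q).trans (by omega))

theorem gaussMean_hermiteReal_mul_self (n : ℕ) :
    gaussMean (hermiteReal n * hermiteReal n) = n.factorial := by
  induction n with
  | zero => simp [hermiteReal_zero, gaussMean_one]
  | succ n ih =>
    rw [gaussMean_hermiteReal_succ_mul, derivative_hermiteReal_succ, mul_left_comm,
      gaussMean_C_mul, ih, Nat.factorial_succ]
    push_cast
    ring

theorem gaussL2Norm_eq (p : ℝ[X]) : gaussL2Norm p = ENNReal.ofReal √(gaussMean (p * p)) := by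
  have hp : MemLp (fun x => p.eval x) 2 (gaussianReal 0 1) := by
    rw [memLp_two_iff_integrable_sq p.continuous.aestronglyMeasurable]
    exact (integrable_eval_gaussianReal (p ^ 2)).congr (ae_of_all _ fun x => eval_pow 2)
  rw [gaussL2Norm, hp.eLpNorm_eq_integral_rpow_norm two_ne_zero ENNReal.ofNat_ne_top,
    gaussMean_apply, Real.sqrt_eq_rpow]
  simp [sq]

/-! ### Interpolation as a remainder, and Gauss quadrature. -/

theorem natDegree_modByMonic_hermiteReal_le (i : ℕ) (p : ℝ[X]) :
    (p %ₘ hermiteReal (i + 1)).natDegree ≤ i := by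
  have h := natDegree_modByMonic_lt p (hermiteReal_monic (i + 1)) fun h => by
    simpa [h] using natDegree_hermiteReal (i + 1)
  rw [natDegree_hermiteReal] at h
  omega

/-- The difference is `He_{i+1}` times quotient times `q`. The truncated subtraction is the degree
of the quotient, which is zero when `p` has small degree. -/
theorem gaussMean_modByMonic_hermiteReal_mul (i : ℕ) (p q : ℝ[X])
    (h : p.natDegree - (i + 1) + q.natDegree ≤ i) :
    gaussMean (p %ₘ hermiteReal (i + 1) * q) = gaussMean (p * q) := by
  conv_rhs => rw [← modByMonic_add_div p (hermiteReal (i + 1)), add_mul, map_add, mul_assoc]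
  rw [gaussMean_hermiteReal_mul_eq_zero, add_zero]
  refine natDegree_mul_le.trans ?_
  rwa [natDegree_divByMonic _ (hermiteReal_monic _), natDegree_hermiteReal]

theorem eval_modByMonic_of_mem_nodes {i : ℕ} {x : ℝ} (hx : x ∈ gaussHermiteNodes i) (p : ℝ[X]) :
    (p %ₘ hermiteReal (i + 1)).eval x = p.eval x := by
  conv_rhs => rw [← modByMonic_add_div p (hermiteReal (i + 1))]
  simp [mem_gaussHermiteNodes.1 hx]

theorem gaussHermiteInterp_eval (i : ℕ) (p : ℝ[X]) :
    gaussHermiteInterp i (fun x => p.eval x) = p %ₘ hermiteReal (i + 1) := by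
  refine (Lagrange.eq_interpolate_of_eval_eq _ (Set.injOn_id _) ?_
    fun x hx => eval_modByMonic_of_mem_nodes hx p).symm
  rw [card_gaussHermiteNodes]
  refine lt_of_le_of_lt degree_le_natDegree ?_
  exact_mod_cast Nat.lt_succ_of_le (natDegree_modByMonic_hermiteReal_le i p)

/-- The weights of the Gauss-Hermite quadrature rule. -/
noncomputable def gaussHermiteWeight (i : ℕ) (x : ℝ) : ℝ :=
  gaussMean (Lagrange.basis (gaussHermiteNodes i) id x)

theorem sum_gaussHermiteWeight_mul (i : ℕ) (p : ℝ[X]) :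
    ∑ x ∈ gaussHermiteNodes i, gaussHermiteWeight i x * p.eval x =
      gaussMean (p %ₘ hermiteReal (i + 1)) := by
  rw [← gaussHermiteInterp_eval, gaussHermiteInterp, Lagrange.interpolate_apply, map_sum]
  refine Finset.sum_congr rfl fun x _ => ?_
  rw [gaussMean_C_mul, gaussHermiteWeight, mul_comm]

theorem gaussMean_modByMonic_hermiteReal (i : ℕ) (p : ℝ[X]) (h : p.natDegree ≤ 2 * i + 1) :
    gaussMean (p %ₘ hermiteReal (i + 1)) = gaussMean p := by
  have := gaussMean_modByMonic_hermiteReal_mul i p 1 (by simp; omega)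
  simpa using this

/-- A fundamental polynomial `b` agrees with `b²` at the nodes, and `b²` has degree `2i`, so
exactness makes the weight the mean of a square. -/
theorem gaussHermiteWeight_nonneg {i : ℕ} {x : ℝ} (hx : x ∈ gaussHermiteNodes i) :
    0 ≤ gaussHermiteWeight i x := by
  set b := Lagrange.basis (gaussHermiteNodes i) id x with hb
  have hdeg : b.natDegree = i := by
    rw [hb, Lagrange.natDegree_basis (Set.injOn_id _) hx, card_gaussHermiteNodes]
    rfl
  have h1 : b = (b * b) %ₘ hermiteReal (i + 1) := by
    refine Polynomial.eq_of_degrees_lt_of_eval_finset_eq (gaussHermiteNodes i) ?_ ?_ ?_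
    · rw [card_gaussHermiteNodes]
      refine lt_of_le_of_lt degree_le_natDegree ?_
      exact_mod_cast Nat.lt_succ_of_le hdeg.le
    · rw [card_gaussHermiteNodes]
      refine lt_of_le_of_lt degree_le_natDegree ?_
      exact_mod_cast Nat.lt_succ_of_le (natDegree_modByMonic_hermiteReal_le i _)
    · intro y hy
      rw [eval_modByMonic_of_mem_nodes hy, eval_mul]
      rcases eq_or_ne x y with rfl | hxy
      · have : b.eval (id x) = 1 := Lagrange.eval_basis_self (Set.injOn_id _) hx
        simp only [id] at this
        simp [this]
      · have : b.eval (id y) = 0 := Lagrange.eval_basis_of_ne hxy hy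
        simp only [id] at this
        simp [this]
  rw [gaussHermiteWeight, ← hb, h1, gaussMean_modByMonic_hermiteReal]
  · exact gaussMean_mul_self_nonneg b
  · refine natDegree_mul_le.trans ?_
    omega

theorem gaussMean_interp_mul_self (i : ℕ) (p : ℝ[X]) :
    gaussMean (gaussHermiteInterp i (fun x => p.eval x) * gaussHermiteInterp i (fun x => p.eval x)) =
      ∑ x ∈ gaussHermiteNodes i, gaussHermiteWeight i x * p.eval x ^ 2 := by
  rw [gaussHermiteInterp_eval]
  set r := p %ₘ hermiteReal (i + 1) with hr
  have hdeg : r.natDegree ≤ i := natDegree_modByMonic_hermiteReal_le i p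
  rw [← gaussMean_modByMonic_hermiteReal i (r * r) (natDegree_mul_le.trans (by omega)),
    ← sum_gaussHermiteWeight_mul]
  refine Finset.sum_congr rfl fun x hx => ?_
  rw [eval_mul, hr, eval_modByMonic_of_mem_nodes hx, sq]

/-! ### Quadrature moments are dominated by Gaussian moments. -/

theorem gaussMean_X_mul_mul_hermiteReal_succ (p : ℝ[X]) (j : ℕ) :
    gaussMean (X * p * hermiteReal (j + 1)) =
      gaussMean (p * hermiteReal (j + 2)) + (j + 1) * gaussMean (p * hermiteReal j) := by
  rw [← gaussMean_C_mul, ← map_add, hermiteReal_add_two]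
  congr 1
  ring

theorem gaussMean_X_mul_mul_hermiteReal_le {p q : ℝ[X]}
    (h : ∀ j, 0 ≤ gaussMean (p * hermiteReal j) ∧
      gaussMean (p * hermiteReal j) ≤ gaussMean (q * hermiteReal j)) (j : ℕ) :
    0 ≤ gaussMean (X * p * hermiteReal j) ∧
      gaussMean (X * p * hermiteReal j) ≤ gaussMean (X * q * hermiteReal j) := by
  rcases j with _ | j
  · have h1 := h 1
    simpa [hermiteReal_zero, hermiteReal_one, mul_comm] using h1
  · rw [gaussMean_X_mul_mul_hermiteReal_succ, gaussMean_X_mul_mul_hermiteReal_succ]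
    obtain ⟨h1, h2⟩ := h (j + 2)
    obtain ⟨h3, h4⟩ := h j
    constructor
    · positivity
    · gcongr

/-- Comparing all Hermite coefficients, not just the mean `j = 0`, makes the induction close:
multiplication by `X` preserves the inequalities, and reducing `X * r` only removes a multiple of
`He_{i+1}`, invisible to `He_j` for `j ≤ i`. For `j > i` the remainder has coefficient zero. -/
theorem gaussMean_X_pow_modByMonic_mul_hermiteReal_le (i m j : ℕ) :
    0 ≤ gaussMean (X ^ m %ₘ hermiteReal (i + 1) * hermiteReal j) ∧
      gaussMean (X ^ m %ₘ hermiteReal (i + 1) * hermiteReal j) ≤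
        gaussMean (X ^ m * hermiteReal j) := by
  induction m generalizing j with
  | zero =>
    have h1 : (1 : ℝ[X]) %ₘ hermiteReal (i + 1) = 1 := by
      rw [modByMonic_eq_self_iff (hermiteReal_monic _), degree_one,
        degree_eq_natDegree (hermiteReal_monic _).ne_zero, natDegree_hermiteReal]
      exact_mod_cast Nat.succ_pos i
    rw [pow_zero, h1]
    refine ⟨?_, le_rfl⟩
    rcases j with _ | j
    · simp [hermiteReal_zero, gaussMean_one]
    · rw [mul_comm, gaussMean_hermiteReal_mul_eq_zero _ _ (by simp)]
  | succ m ih =>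
    set r := (X ^ m : ℝ[X]) %ₘ hermiteReal (i + 1) with hr
    have hrd : r.natDegree ≤ i := natDegree_modByMonic_hermiteReal_le i _
    have hmod : (X ^ (m + 1) : ℝ[X]) %ₘ hermiteReal (i + 1) = (X * r) %ₘ hermiteReal (i + 1) := by
      rw [pow_succ', mul_modByMonic, mul_modByMonic X r, hr,
        (modByMonic_eq_self_iff (hermiteReal_monic _)).2 (degree_modByMonic_lt _
          (hermiteReal_monic (i + 1)))]
    obtain ⟨h1, h2⟩ := gaussMean_X_mul_mul_hermiteReal_le ih j
    rw [hmod, pow_succ']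
    rcases le_or_gt j i with hj | hj
    · have hd : (X * r).natDegree ≤ i + 1 := by
        refine natDegree_mul_le.trans ?_
        rw [natDegree_X]
        omega
      rw [gaussMean_modByMonic_hermiteReal_mul _ _ _ (by rw [natDegree_hermiteReal]; omega)]
      exact ⟨h1, h2⟩
    · obtain ⟨k, rfl⟩ := Nat.exists_eq_add_of_lt hj
      rw [mul_comm (_ %ₘ _), gaussMean_hermiteReal_mul_eq_zero]
      · exact ⟨le_rfl, h1.trans h2⟩
      · exact (natDegree_modByMonic_hermiteReal_le i _).trans (by omega)

theorem sum_gaussHermiteWeight_mul_pow_le (i m : ℕ) :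
    ∑ x ∈ gaussHermiteNodes i, gaussHermiteWeight i x * x ^ m ≤ gaussMean (X ^ m) := by
  have h := (gaussMean_X_pow_modByMonic_mul_hermiteReal_le i m 0).2
  rw [hermiteReal_zero, mul_one, mul_one, ← sum_gaussHermiteWeight_mul] at h
  simpa using h

/-! ### Quadrature of Gaussian exponentials. -/

theorem gaussianPDFReal_mul_exp (a x : ℝ) :
    gaussianPDFReal 0 1 x * Real.exp (a * x ^ 2) =
      (√(2 * Real.pi))⁻¹ * Real.exp (-(1 / 2 - a) * x ^ 2) := by
  rw [gaussianPDFReal_zero_one, mul_assoc, ← Real.exp_add]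
  ring_nf

theorem integrable_exp_mul_sq_gaussianReal {a : ℝ} (ha : a < 1 / 2) :
    Integrable (fun x => Real.exp (a * x ^ 2)) (gaussianReal 0 1) := by
  rw [integrable_gaussianReal_iff]
  simp_rw [gaussianPDFReal_mul_exp]
  exact (integrable_exp_neg_mul_sq (by linarith)).const_mul _

theorem integral_exp_mul_sq_gaussianReal {a : ℝ} (ha : a < 1 / 2) :
    ∫ x, Real.exp (a * x ^ 2) ∂gaussianReal 0 1 = (√(1 - 2 * a))⁻¹ := by
  rw [integral_gaussianReal_eq_integral_smul one_ne_zero]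
  simp_rw [smul_eq_mul, gaussianPDFReal_mul_exp]
  rw [integral_const_mul, integral_gaussian, ← Real.sqrt_inv, ← Real.sqrt_inv,
    ← Real.sqrt_mul (by positivity)]
  congr 1
  have : 1 - 2 * a ≠ 0 := by linarith
  have : 1 / 2 - a ≠ 0 := by linarith
  field_simp

/-- As `a ≥ 0`, the Taylor coefficients are nonnegative and the monomial bound applies termwise; the
partial sums lie below the exponential. -/
theorem sum_gaussHermiteWeight_mul_exp_le (i : ℕ) {a : ℝ} (ha0 : 0 ≤ a) (ha : a < 1 / 2) :
    ∑ x ∈ gaussHermiteNodes i, gaussHermiteWeight i x * Real.exp (a * x ^ 2) ≤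
      (√(1 - 2 * a))⁻¹ := by
  have hlim : Filter.Tendsto (fun N : ℕ => ∑ x ∈ gaussHermiteNodes i, gaussHermiteWeight i x *
      ∑ k ∈ Finset.range N, (a * x ^ 2) ^ k / (k.factorial : ℝ)) Filter.atTop
      (nhds (∑ x ∈ gaussHermiteNodes i, gaussHermiteWeight i x * Real.exp (a * x ^ 2))) := by
    refine tendsto_finsetSum _ fun x _ => Filter.Tendsto.const_mul _ ?_
    rw [Real.exp_eq_exp_ℝ]
    exact (NormedSpace.expSeries_div_hasSum_exp (a * x ^ 2)).tendsto_sum_nat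
  refine le_of_tendsto' hlim fun N => ?_
  calc ∑ x ∈ gaussHermiteNodes i, gaussHermiteWeight i x *
        ∑ k ∈ Finset.range N, (a * x ^ 2) ^ k / (k.factorial : ℝ)
      = ∑ k ∈ Finset.range N, a ^ k / (k.factorial : ℝ) *
          ∑ x ∈ gaussHermiteNodes i, gaussHermiteWeight i x * x ^ (2 * k) := by
        simp_rw [Finset.mul_sum]
        rw [Finset.sum_comm]
        refine Finset.sum_congr rfl fun k _ => Finset.sum_congr rfl fun x _ => ?_
        rw [mul_pow, ← pow_mul]
        ring
    _ ≤ ∑ k ∈ Finset.range N, a ^ k / (k.factorial : ℝ) * gaussMean (X ^ (2 * k)) := by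
        gcongr with k _
        exact sum_gaussHermiteWeight_mul_pow_le i (2 * k)
    _ = gaussMean (∑ k ∈ Finset.range N, C (a ^ k / (k.factorial : ℝ)) * X ^ (2 * k)) := by
        rw [map_sum]
        simp_rw [gaussMean_C_mul]
    _ ≤ ∫ x, Real.exp (a * x ^ 2) ∂gaussianReal 0 1 := by
        rw [gaussMean_apply]
        refine integral_mono (integrable_eval_gaussianReal _)
          (integrable_exp_mul_sq_gaussianReal ha) fun x => ?_
        refine le_trans (le_of_eq ?_) (Real.sum_le_exp_of_nonneg (x := a * x ^ 2) (by positivity) N)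
        rw [eval_finsetSum]
        refine Finset.sum_congr rfl fun k _ => ?_
        simp only [eval_mul, eval_C, eval_pow, eval_X]
        rw [mul_pow, ← pow_mul]
        ring
    _ = (√(1 - 2 * a))⁻¹ := integral_exp_mul_sq_gaussianReal ha

theorem sum_gaussHermiteWeight_mul_exp_half_le {i ν : ℕ} (h : i + 1 ≤ ν) :
    ∑ x ∈ gaussHermiteNodes i, gaussHermiteWeight i x * Real.exp (x ^ 2 / 2) ≤
      √(4 * ν - 2) * Real.exp (1 / 2) := by
  have hν : (i : ℝ) + 1 ≤ ν := by exact_mod_cast h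
  have hi : (0 : ℝ) ≤ i := by positivity
  set D : ℝ := 4 * ν - 2 with hD
  have hD2 : 2 ≤ D := by linarith
  have hinv : D⁻¹ ≤ 1 / 2 := by
    rw [one_div]
    exact inv_anti₀ (by norm_num) hD2
  have hinv0 : 0 < D⁻¹ := by positivity
  -- Here `1 - 2a = 1/D`, and the missing exponent `x²/(2D)` is at most `1/2` on the nodes since `x²
  -- < D`.
  have key := sum_gaussHermiteWeight_mul_exp_le i (a := (1 - D⁻¹) / 2) (by linarith) (by linarith)
  rw [show 1 - 2 * ((1 - D⁻¹) / 2) = D⁻¹ by ring, Real.sqrt_inv, inv_inv] at key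
  refine le_trans ?_ (mul_le_mul_of_nonneg_right key (Real.exp_pos _).le)
  rw [Finset.sum_mul]
  refine Finset.sum_le_sum fun x hx => ?_
  rw [mul_assoc, ← Real.exp_add]
  refine mul_le_mul_of_nonneg_left (Real.exp_le_exp.2 ?_) (gaussHermiteWeight_nonneg hx)
  have hx2 := sq_lt_of_mem_gaussHermiteNodes hx
  have : D⁻¹ * x ^ 2 ≤ 1 := by
    rw [inv_mul_le_one₀ (by linarith)]
    linarith
  linarith

/-! ### The mean of `(2|sin θ|)^(-1/2)` over the circle. -/

theorem two_mul_abs_sin_rpow_le {θ : ℝ} (h0 : 0 < θ) (h1 : θ ≤ 1) :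
    (2 * |Real.sin θ|) ^ (-1 / 2 : ℝ) ≤ (3 / 2) ^ (-1 / 2 : ℝ) * θ ^ (-1 / 2 : ℝ) := by
  have hs := Real.sin_gt_sub_cube h0
  rw [← Real.mul_rpow (by norm_num) h0.le]
  refine Real.rpow_le_rpow_of_nonpos (by positivity) ?_ (by norm_num)
  have : θ ^ 3 ≤ θ := by
    have := pow_le_pow_of_le_one h0.le h1 (show 1 ≤ 3 by norm_num)
    simpa using this
  linarith [le_abs_self (Real.sin θ)]

theorem two_mul_abs_sin_rpow_le_const {θ : ℝ} (h0 : 1 ≤ θ) (h1 : θ ≤ Real.pi / 2) :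
    (2 * |Real.sin θ|) ^ (-1 / 2 : ℝ) ≤ (3 / 2) ^ (-1 / 2 : ℝ) := by
  have hs := Real.sin_gt_sub_cube one_pos
  have hm : Real.sin 1 ≤ Real.sin θ :=
    Real.sin_le_sin_of_le_of_le_pi_div_two (by linarith [Real.pi_gt_three]) h1 h0
  refine Real.rpow_le_rpow_of_nonpos (by positivity) ?_ (by norm_num)
  linarith [le_abs_self (Real.sin θ)]

theorem aestronglyMeasurable_two_mul_abs_sin_rpow (μ : Measure ℝ) :
    AEStronglyMeasurable (fun θ : ℝ => (2 * |Real.sin θ|) ^ (-1 / 2 : ℝ)) μ := by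
  have : Measurable fun θ : ℝ => (2 * |Real.sin θ|) ^ (-1 / 2 : ℝ) := by fun_prop
  exact this.aestronglyMeasurable

theorem integral_two_mul_abs_sin_rpow_zero_one :
    IntervalIntegrable (fun θ : ℝ => (2 * |Real.sin θ|) ^ (-1 / 2 : ℝ)) volume 0 1 ∧
      ∫ θ in (0 : ℝ)..1, (2 * |Real.sin θ|) ^ (-1 / 2 : ℝ) ≤ (3 / 2) ^ (-1 / 2 : ℝ) * 2 := by
  have hi : IntervalIntegrable (fun θ : ℝ => (3 / 2 : ℝ) ^ (-1 / 2 : ℝ) * θ ^ (-1 / 2 : ℝ))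
      volume 0 1 :=
    (intervalIntegral.intervalIntegrable_rpow' (by norm_num)).const_mul _
  have hk : IntervalIntegrable (fun θ : ℝ => (2 * |Real.sin θ|) ^ (-1 / 2 : ℝ)) volume 0 1 := by
    refine hi.mono_fun' (aestronglyMeasurable_two_mul_abs_sin_rpow _) ?_
    refine (ae_restrict_iff' measurableSet_uIoc).2 (ae_of_all _ fun θ hθ => ?_)
    rw [Set.uIoc_of_le zero_le_one] at hθ
    refine (Real.norm_of_nonneg (by positivity)).trans_le ?_
    exact two_mul_abs_sin_rpow_le hθ.1 hθ.2
  refine ⟨hk, ?_⟩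
  calc ∫ θ in (0 : ℝ)..1, (2 * |Real.sin θ|) ^ (-1 / 2 : ℝ)
      ≤ ∫ θ in (0 : ℝ)..1, (3 / 2 : ℝ) ^ (-1 / 2 : ℝ) * θ ^ (-1 / 2 : ℝ) := by
        refine intervalIntegral.integral_mono_on_of_le_Ioo zero_le_one hk hi fun θ hθ => ?_
        exact two_mul_abs_sin_rpow_le hθ.1 hθ.2.le
    _ = (3 / 2) ^ (-1 / 2 : ℝ) * 2 := by
        rw [intervalIntegral.integral_const_mul, integral_rpow (Or.inl (by norm_num))]
        norm_num

theorem integral_two_mul_abs_sin_rpow_one_pi_div_two :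
    IntervalIntegrable (fun θ : ℝ => (2 * |Real.sin θ|) ^ (-1 / 2 : ℝ)) volume 1 (Real.pi / 2) ∧
      ∫ θ in (1 : ℝ)..(Real.pi / 2), (2 * |Real.sin θ|) ^ (-1 / 2 : ℝ) ≤
        (3 / 2) ^ (-1 / 2 : ℝ) * (Real.pi / 2 - 1) := by
  have hle : 1 ≤ Real.pi / 2 := by linarith [Real.pi_gt_three]
  have hi : IntervalIntegrable (fun _ : ℝ => (3 / 2 : ℝ) ^ (-1 / 2 : ℝ)) volume 1 (Real.pi / 2) :=
    intervalIntegrable_const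
  have hk : IntervalIntegrable (fun θ : ℝ => (2 * |Real.sin θ|) ^ (-1 / 2 : ℝ)) volume 1
      (Real.pi / 2) := by
    refine hi.mono_fun' (aestronglyMeasurable_two_mul_abs_sin_rpow _) ?_
    refine (ae_restrict_iff' measurableSet_uIoc).2 (ae_of_all _ fun θ hθ => ?_)
    rw [Set.uIoc_of_le hle] at hθ
    refine (Real.norm_of_nonneg (by positivity)).trans_le ?_
    exact two_mul_abs_sin_rpow_le_const hθ.1.le hθ.2
  refine ⟨hk, ?_⟩
  calc ∫ θ in (1 : ℝ)..(Real.pi / 2), (2 * |Real.sin θ|) ^ (-1 / 2 : ℝ)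
      ≤ ∫ _ in (1 : ℝ)..(Real.pi / 2), (3 / 2 : ℝ) ^ (-1 / 2 : ℝ) := by
        refine intervalIntegral.integral_mono_on hle hk hi fun θ hθ => ?_
        exact two_mul_abs_sin_rpow_le_const hθ.1 hθ.2
    _ = (3 / 2) ^ (-1 / 2 : ℝ) * (Real.pi / 2 - 1) := by
        rw [intervalIntegral.integral_const, smul_eq_mul, mul_comm]

theorem integral_two_mul_abs_sin_rpow_zero_two_pi :
    IntervalIntegrable (fun θ : ℝ => (2 * |Real.sin θ|) ^ (-1 / 2 : ℝ)) volume 0 (2 * Real.pi) ∧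
      ∫ θ in (0 : ℝ)..(2 * Real.pi), (2 * |Real.sin θ|) ^ (-1 / 2 : ℝ) ≤
        67 / 50 * (2 * Real.pi) := by
  set k : ℝ → ℝ := fun θ : ℝ => (2 * |Real.sin θ|) ^ (-1 / 2 : ℝ) with hk
  obtain ⟨h1, h2⟩ := integral_two_mul_abs_sin_rpow_zero_one
  obtain ⟨h3, h4⟩ := integral_two_mul_abs_sin_rpow_one_pi_div_two
  have h5 := h1.trans h3
  have e5 := intervalIntegral.integral_add_adjacent_intervals h1 h3
  have hrefl : (fun θ => k (Real.pi - θ)) = k := by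
    ext θ
    simp [hk, Real.sin_pi_sub]
  have hshift : (fun θ => k (θ - Real.pi)) = k := by
    ext θ
    simp [hk, Real.sin_sub_pi]
  have h6 : IntervalIntegrable k volume (Real.pi / 2) Real.pi := by
    have := h5.comp_sub_left Real.pi
    rw [hrefl, sub_zero, sub_half] at this
    exact this.symm
  have e6 : ∫ θ in (Real.pi / 2)..Real.pi, k θ = ∫ θ in (0 : ℝ)..(Real.pi / 2), k θ := by
    have := intervalIntegral.integral_comp_sub_left (a := 0) (b := Real.pi / 2) k Real.pi
    rw [hrefl, sub_zero, sub_half] at this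
    exact this.symm
  have h7 := h5.trans h6
  have e7 := intervalIntegral.integral_add_adjacent_intervals h5 h6
  have h8 : IntervalIntegrable k volume Real.pi (2 * Real.pi) := by
    have := h7.comp_sub_right Real.pi
    rwa [hshift, zero_add, ← two_mul] at this
  have e8 : ∫ θ in Real.pi..(2 * Real.pi), k θ = ∫ θ in (0 : ℝ)..Real.pi, k θ := by
    have := intervalIntegral.integral_comp_sub_right (a := Real.pi) (b := 2 * Real.pi) k Real.pi
    rw [hshift, sub_self, two_mul, add_sub_cancel_right] at this
    rw [two_mul, this]
  have e9 := intervalIntegral.integral_add_adjacent_intervals h7 h8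
  refine ⟨h7.trans h8, ?_⟩
  -- The bound for the mean is `√(2/3) (1 + 2/π) ≈ 1.336`, just below `67/50`.
  have hκ : (3 / 2 : ℝ) ^ (-1 / 2 : ℝ) ≤ 0.8165 := by
    rw [neg_div, Real.rpow_neg (by norm_num), ← Real.sqrt_eq_rpow, ← Real.sqrt_inv]
    exact Real.sqrt_le_iff.2 (by norm_num)
  have hb : ∫ θ in (0 : ℝ)..(2 * Real.pi), k θ ≤
      (3 / 2 : ℝ) ^ (-1 / 2 : ℝ) * (4 + 2 * Real.pi) := by
    simp only [hk] at e6 e8 ⊢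
    linarith
  have hpi := Real.pi_gt_d2
  refine hb.trans ((mul_le_mul_of_nonneg_right hκ (by linarith)).trans ?_)
  linarith

/-! ### The diagonal Mehler kernel and its Taylor coefficients. -/

/-- The generating function of the squared normalized Hermite polynomials (Mehler's formula on the
diagonal). -/
noncomputable def mehlerDiag (x : ℝ) (t : ℂ) : ℂ :=
  (1 - t ^ 2) ^ ((-1 / 2 : ℝ) : ℂ) * Complex.exp (x ^ 2 * (t / (1 + t)))

theorem one_sub_sq_mem_slitPlane {t : ℂ} (ht : ‖t‖ < 1) : 1 - t ^ 2 ∈ Complex.slitPlane := by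
  left
  have h1 : (t ^ 2).re ≤ ‖t ^ 2‖ := Complex.re_le_norm _
  rw [norm_pow] at h1
  have h2 : ‖t‖ ^ 2 < 1 := pow_lt_one₀ (norm_nonneg _) ht two_ne_zero
  rw [Complex.sub_re, Complex.one_re]
  linarith

theorem one_add_ne_zero_of_norm_lt_one {t : ℂ} (ht : ‖t‖ < 1) : 1 + t ≠ 0 := by
  intro h
  rw [eq_neg_of_add_eq_zero_right h] at ht
  simp at ht

theorem one_sub_ne_zero_of_norm_lt_one {t : ℂ} (ht : ‖t‖ < 1) : 1 - t ≠ 0 := by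
  intro h
  rw [← sub_eq_zero.1 h] at ht
  simp at ht

theorem hasDerivAt_mehlerDiag (x : ℝ) {t : ℂ} (ht : ‖t‖ < 1) :
    HasDerivAt (mehlerDiag x)
      (mehlerDiag x t * (t / ((1 - t) * (1 + t)) + x ^ 2 / (1 + t) ^ 2)) t := by
  have h1 := one_add_ne_zero_of_norm_lt_one ht
  have h2 := one_sub_ne_zero_of_norm_lt_one ht
  have h3 : 1 - t ^ 2 ≠ 0 := Complex.slitPlane_ne_zero (one_sub_sq_mem_slitPlane ht)
  have d1 : HasDerivAt (fun t : ℂ => 1 - t ^ 2) (-(2 * t)) t :=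
    ((hasDerivAt_pow 2 t).const_sub 1).congr_deriv (by simp)
  have d2 := d1.cpow_const (c := ((-1 / 2 : ℝ) : ℂ)) (one_sub_sq_mem_slitPlane ht)
  have d3 : HasDerivAt (fun t : ℂ => (x : ℂ) ^ 2 * (t / (1 + t))) (x ^ 2 / (1 + t) ^ 2) t := by
    refine (((hasDerivAt_id t).div ((hasDerivAt_id t).const_add 1) h1).const_mul _).congr_deriv ?_
    simp
    ring
  refine (d2.mul d3.cexp).congr_deriv ?_
  rw [mehlerDiag, Complex.cpow_sub _ _ h3, Complex.cpow_one]
  have h4 : (1 - t ^ 2) = (1 - t) * (1 + t) := by ring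
  generalize (1 - t ^ 2) ^ ((-1 / 2 : ℝ) : ℂ) = A
  rw [h4]
  push_cast
  field_simp

/-- The unnormalized Laurent coefficients of the diagonal Mehler kernel. -/
noncomputable def mehlerCoeff (x r : ℝ) (m : ℤ) : ℂ :=
  ∮ t in C(0, r), mehlerDiag x t * t ^ m

theorem continuousOn_mehlerDiag_mul_zpow (x : ℝ) {r : ℝ} (hr0 : 0 < r) (hr : r < 1) (m : ℤ) :
    ContinuousOn (fun t => mehlerDiag x t * t ^ m) (Metric.sphere 0 r) := by
  intro t ht
  have ht' : ‖t‖ = r := by simpa using ht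
  have ht0 : t ≠ 0 := by
    rintro rfl
    simp at ht'
    linarith
  exact ((hasDerivAt_mehlerDiag x (by linarith)).continuousAt.mul
    (continuousAt_zpow₀ _ _ (Or.inl ht0))).continuousWithinAt

/-- The circle integral of the derivative of `(1-t)(1+t)² G(t) t^m` vanishes, `G` being the kernel;
the polynomial factor clears the denominators of `G'/G`. -/
theorem mehlerCoeff_recurrence (x : ℝ) {r : ℝ} (hr0 : 0 < r) (hr : r < 1) (m : ℤ) :
    (m : ℂ) * mehlerCoeff x r (m - 1) + (1 + x ^ 2 + m) * mehlerCoeff x r m -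
      (1 + x ^ 2 + m) * mehlerCoeff x r (m + 1) - (2 + m) * mehlerCoeff x r (m + 2) = 0 := by
  have hI : ∀ (c : ℂ) (m : ℤ), CircleIntegrable (fun t => c * (mehlerDiag x t * t ^ m)) 0 r :=
    fun c m => ((continuousOn_mehlerDiag_mul_zpow x hr0 hr m).const_smul c).circleIntegrable hr0.le
  have key := circleIntegral.integral_eq_zero_of_hasDerivWithinAt (c := 0) (R := r)
    (f := fun t => ((1 - t) * (1 + t) ^ 2) * (mehlerDiag x t * t ^ m))
    (f' := fun t => (m : ℂ) * (mehlerDiag x t * t ^ (m - 1)) +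
      (1 + x ^ 2 + m) * (mehlerDiag x t * t ^ m) -
      (1 + x ^ 2 + m) * (mehlerDiag x t * t ^ (m + 1)) -
      (2 + m) * (mehlerDiag x t * t ^ (m + 2))) hr0.le ?_
  · have h1 : CircleIntegrable (fun t => (m : ℂ) * (mehlerDiag x t * t ^ (m - 1)) +
        (1 + x ^ 2 + m) * (mehlerDiag x t * t ^ m)) 0 r := (hI _ _).add (hI _ _)
    have h2 : CircleIntegrable (fun t => (m : ℂ) * (mehlerDiag x t * t ^ (m - 1)) +
        (1 + x ^ 2 + m) * (mehlerDiag x t * t ^ m) -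
        (1 + x ^ 2 + m) * (mehlerDiag x t * t ^ (m + 1))) 0 r := h1.sub (hI _ _)
    rw [circleIntegral.integral_sub h2 (hI _ _), circleIntegral.integral_sub h1 (hI _ _),
      circleIntegral.integral_add (hI _ _) (hI _ _), circleIntegral.integral_const_mul,
      circleIntegral.integral_const_mul, circleIntegral.integral_const_mul,
      circleIntegral.integral_const_mul] at key
    exact key
  · intro t ht
    have ht' : ‖t‖ = r := by simpa using ht
    have ht0 : t ≠ 0 := by
      rintro rfl
      simp at ht'
      linarith
    have ht1 : ‖t‖ < 1 := by linarith
    have h1 := one_add_ne_zero_of_norm_lt_one ht1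
    have h2 := one_sub_ne_zero_of_norm_lt_one ht1
    have d0 : HasDerivAt (fun t : ℂ => (1 - t) * (1 + t) ^ 2)
        (-1 * (1 + t) ^ 2 + (1 - t) * (2 * (1 + t))) t := by
      refine (((hasDerivAt_id t).const_sub 1).mul
        (((hasDerivAt_id t).const_add 1).pow 2)).congr_deriv ?_
      simp
    have d1 := (hasDerivAt_mehlerDiag x ht1).mul (hasDerivAt_zpow m t (Or.inl ht0))
    refine ((d0.mul d1).congr_deriv ?_).hasDerivWithinAt
    simp only [Pi.mul_apply]
    generalize mehlerDiag x t = G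
    rw [zpow_add₀ ht0, zpow_add₀ ht0, zpow_sub₀ ht0, zpow_one]
    generalize t ^ m = P
    simp only [zpow_ofNat]
    field_simp
    ring

theorem diffContOnCl_mehlerDiag (x : ℝ) {r : ℝ} (hr : r < 1) :
    DiffContOnCl ℂ (mehlerDiag x) (Metric.ball 0 r) := by
  refine DifferentiableOn.diffContOnCl fun t ht => ?_
  have ht' : ‖t‖ ≤ r := by simpa using Metric.closure_ball_subset_closedBall ht
  exact (hasDerivAt_mehlerDiag x (by linarith)).differentiableAt.differentiableWithinAt

theorem mehlerCoeff_neg_one (x : ℝ) {r : ℝ} (hr0 : 0 < r) (hr : r < 1) :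
    mehlerCoeff x r (-1) = 2 * Real.pi * Complex.I := by
  have h := (diffContOnCl_mehlerDiag x hr).circleIntegral_sub_inv_smul (w := 0) (by simpa using hr0)
  have h0 : mehlerDiag x 0 = 1 := by simp [mehlerDiag]
  rw [h0, smul_eq_mul, mul_one] at h
  rw [mehlerCoeff, ← h]
  congr 1
  ext t
  simp [mul_comm]

theorem mehlerCoeff_natCast (x : ℝ) {r : ℝ} (hr0 : 0 < r) (hr : r < 1) (k : ℕ) :
    mehlerCoeff x r k = 0 := by
  have h2 : DiffContOnCl ℂ (fun t : ℂ => t ^ k) (Metric.ball 0 r) :=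
    (differentiable_pow k).diffContOnCl
  have h := ((diffContOnCl_mehlerDiag x hr).smul h2).circleIntegral_eq_zero hr0.le
  rw [mehlerCoeff, ← h]
  congr 1

/-- The square of the normalized Hermite polynomial. -/
noncomputable def hermiteSq (x : ℝ) (n : ℕ) : ℝ :=
  (hermiteReal n).eval x ^ 2 / (n.factorial : ℝ)

theorem hermiteSq_add_three (x : ℝ) (n : ℕ) :
    ((n : ℝ) + 3) * hermiteSq x (n + 3) = (x ^ 2 - (n + 2)) * hermiteSq x (n + 2) +
      (n + 2 - x ^ 2) * hermiteSq x (n + 1) + (n + 1) * hermiteSq x n := by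
  simp only [hermiteSq]
  rw [eval_hermiteReal_add_two (n + 1), eval_hermiteReal_add_two, Nat.factorial_succ,
    Nat.factorial_succ (n + 1), Nat.factorial_succ n]
  generalize (hermiteReal (n + 1)).eval x = u
  generalize (hermiteReal n).eval x = v
  push_cast
  field_simp
  ring

/-- Both sides obey the same third-order recurrence, so three consecutive values are carried through
the induction. The Taylor coefficient of `t^n` sits at exponent `-(n+1)`. -/
theorem mehlerCoeff_eq (x : ℝ) {r : ℝ} (hr0 : 0 < r) (hr : r < 1) (n : ℕ) :
    mehlerCoeff x r (-(n + 1)) =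
      2 * Real.pi * Complex.I * hermiteSq x n := by
  have h0 := mehlerCoeff_neg_one x hr0 hr
  have hz0 := mehlerCoeff_natCast x hr0 hr 0
  have hz1 := mehlerCoeff_natCast x hr0 hr 1
  have r1 := mehlerCoeff_recurrence x hr0 hr (-1)
  have r2 := mehlerCoeff_recurrence x hr0 hr (-2)
  norm_num [h0] at hz0 hz1 r1 r2
  rw [hz0, hz1] at r1
  have h1 : mehlerCoeff x r (-2) = 2 * Real.pi * Complex.I * x ^ 2 := by linear_combination -r1
  rw [h1] at r2
  suffices H : ∀ n : ℕ, mehlerCoeff x r (-(n + 1)) =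
      2 * Real.pi * Complex.I * hermiteSq x n ∧
    mehlerCoeff x r (-(n + 2)) = 2 * Real.pi * Complex.I *
      hermiteSq x (n + 1) ∧
    mehlerCoeff x r (-(n + 3)) = 2 * Real.pi * Complex.I *
      hermiteSq x (n + 2) from (H n).1
  intro n
  induction n with
  | zero =>
    refine ⟨by simpa [hermiteSq, hermiteReal_zero] using h0, by simpa [hermiteSq, hermiteReal_one] using h1, ?_⟩
    rw [hermiteSq, eval_hermiteReal_add_two]
    simp [hermiteReal_one, hermiteReal_zero]
    linear_combination (-1 / 2) * r2
  | succ n ih =>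
    obtain ⟨i0, i1, i2⟩ := ih
    have hr3 := mehlerCoeff_recurrence x hr0 hr (-(n + 3))
    rw [show (-(n + 3) - 1 : ℤ) = -(n + 4) by ring, show (-(n + 3) + 1 : ℤ) = -(n + 2) by ring,
      show (-(n + 3) + 2 : ℤ) = -(n + 1) by ring, i0, i1, i2] at hr3
    refine ⟨?_, ?_, ?_⟩
    · rw [← i1]
      congr 1
    · rw [← i2]
      congr 1
    · rw [show (-(((n + 1 : ℕ) : ℤ) + 3)) = -(n + 4) by push_cast; ring]
      have hn3 : (n : ℂ) + 3 ≠ 0 := by exact_mod_cast (by omega : n + 3 ≠ 0)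
      refine mul_left_cancel₀ hn3 ?_
      have hs := congrArg Complex.ofReal (hermiteSq_add_three x n)
      push_cast at hs hr3
      linear_combination (-1) * hr3 - 2 * Real.pi * Complex.I * hs

/-! ### Kernel estimates and the Cramér type inequality. -/

/-- For `t = r e^{iθ}`, `|1-t²|² = (1-r²)² + 4r² sin² θ`. -/
theorem two_mul_abs_sin_le_norm_one_sub_sq {r : ℝ} (hr0 : 0 ≤ r) (θ : ℝ) :
    r * (2 * |Real.sin θ|) ≤ ‖1 - circleMap 0 r θ ^ 2‖ := by
  rw [← sq_le_sq₀ (by positivity) (norm_nonneg _), Complex.sq_norm, Complex.normSq_apply]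
  have h : circleMap 0 r θ = (r * Real.cos θ : ℝ) + (r * Real.sin θ : ℝ) * Complex.I := by
    simp [circleMap, Complex.exp_mul_I]
    ring
  have hre : (1 - circleMap 0 r θ ^ 2).re = 1 - r ^ 2 * (Real.cos θ ^ 2 - Real.sin θ ^ 2) := by
    rw [h]
    generalize Real.cos θ = a
    generalize Real.sin θ = b
    simp [sq]
    ring
  have him : (1 - circleMap 0 r θ ^ 2).im = -2 * r ^ 2 * Real.cos θ * Real.sin θ := by
    rw [h]
    generalize Real.cos θ = a
    generalize Real.sin θ = b
    simp [sq]
    ring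
  rw [hre, him, mul_pow, mul_pow, sq_abs]
  have hc : Real.cos θ ^ 2 = 1 - Real.sin θ ^ 2 := Real.cos_sq' θ
  have h2 : (-2 * r ^ 2 * Real.cos θ * Real.sin θ) * (-2 * r ^ 2 * Real.cos θ * Real.sin θ) =
      4 * r ^ 4 * (Real.cos θ ^ 2) * Real.sin θ ^ 2 := by ring
  rw [h2, hc]
  nlinarith [sq_nonneg (1 - r ^ 2)]

/-- The map `t ↦ 1/(1+t)` sends the unit disc into the half-plane `Re > 1/2`. -/
theorem re_div_one_add_le {t : ℂ} (ht : ‖t‖ < 1) : (t / (1 + t)).re ≤ 1 / 2 := by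
  have h1 := one_add_ne_zero_of_norm_lt_one ht
  have h2 : t / (1 + t) = 1 - (1 + t)⁻¹ := by
    field_simp
    ring
  have hpos : 0 < Complex.normSq (1 + t) := Complex.normSq_pos.2 h1
  have hsq : t.re * t.re + t.im * t.im ≤ 1 := by
    rw [← Complex.normSq_apply, ← Complex.sq_norm]
    exact pow_le_one₀ (norm_nonneg _) ht.le
  have h3 : 1 / 2 ≤ ((1 + t)⁻¹).re := by
    rw [Complex.inv_re, le_div_iff₀ hpos, Complex.normSq_apply]
    simp only [Complex.add_re, Complex.add_im, Complex.one_re, Complex.one_im]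
    nlinarith
  rw [h2, Complex.sub_re, Complex.one_re]
  linarith

theorem norm_mehlerDiag_circleMap_le (x : ℝ) {r θ : ℝ} (hr0 : 0 < r) (hr : r < 1)
    (hθ : Real.sin θ ≠ 0) :
    ‖mehlerDiag x (circleMap 0 r θ)‖ ≤
      r ^ (-1 / 2 : ℝ) * (2 * |Real.sin θ|) ^ (-1 / 2 : ℝ) * Real.exp (x ^ 2 / 2) := by
  have ht : ‖circleMap 0 r θ‖ < 1 := by
    rw [norm_circleMap_zero, abs_of_pos hr0]
    exact hr
  rw [mehlerDiag, norm_mul, Complex.norm_cpow_real, Complex.norm_exp]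
  refine mul_le_mul ?_ (Real.exp_le_exp.2 ?_) (Real.exp_pos _).le (by positivity)
  · rw [← Real.mul_rpow hr0.le (by positivity)]
    exact Real.rpow_le_rpow_of_nonpos (by positivity)
      (two_mul_abs_sin_le_norm_one_sub_sq hr0.le θ) (by norm_num)
  · rw [← Complex.ofReal_pow, Complex.re_ofReal_mul]
    have := mul_le_mul_of_nonneg_left (re_div_one_add_le ht) (sq_nonneg x)
    linarith

theorem ae_sin_ne_zero : ∀ᵐ θ : ℝ, Real.sin θ ≠ 0 := by
  have h : {θ : ℝ | Real.sin θ = 0}.Countable := by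
    have : {θ : ℝ | Real.sin θ = 0} = Set.range fun n : ℤ => (n : ℝ) * Real.pi := by
      ext θ
      simp [Real.sin_eq_zero_iff]
    rw [this]
    exact Set.countable_range _
  exact h.ae_notMem volume

theorem hermiteSq_le_of_lt_one (x : ℝ) (n : ℕ) {r : ℝ} (hr0 : 0 < r) (hr : r < 1) :
    hermiteSq x n ≤ r * r ^ (-(n + 1) : ℤ) * r ^ (-1 / 2 : ℝ) *
      (67 / 50 * Real.exp (x ^ 2 / 2)) := by
  obtain ⟨hi, hle⟩ := integral_two_mul_abs_sin_rpow_zero_two_pi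
  have h1 := mehlerCoeff_eq x hr0 hr n
  set A : ℝ := r * r ^ (-(n + 1) : ℤ) * r ^ (-1 / 2 : ℝ) * Real.exp (x ^ 2 / 2) with hA
  have hA0 : 0 ≤ A := by positivity
  have h2 : ‖mehlerCoeff x r (-(n + 1))‖ ≤
      ∫ θ in (0 : ℝ)..(2 * Real.pi), A * (2 * |Real.sin θ|) ^ (-1 / 2 : ℝ) := by
    rw [mehlerCoeff, circleIntegral]
    refine intervalIntegral.norm_integral_le_of_norm_le Real.two_pi_pos.le ?_ (hi.const_mul _)
    filter_upwards [ae_sin_ne_zero] with θ hθ _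
    have h3 := norm_mehlerDiag_circleMap_le x hr0 hr hθ
    rw [deriv_circleMap, norm_smul, norm_mul, Complex.norm_I, norm_mul, norm_zpow,
      norm_circleMap_zero, abs_of_pos hr0, mul_one]
    calc r * (‖mehlerDiag x (circleMap 0 r θ)‖ * r ^ (-(n + 1) : ℤ))
        ≤ r * (r ^ (-1 / 2 : ℝ) * (2 * |Real.sin θ|) ^ (-1 / 2 : ℝ) * Real.exp (x ^ 2 / 2) *
            r ^ (-(n + 1) : ℤ)) := by gcongr
      _ = A * (2 * |Real.sin θ|) ^ (-1 / 2 : ℝ) := by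
        rw [hA]
        ring
  have hnn : 0 ≤ hermiteSq x n := by
    rw [hermiteSq]
    positivity
  rw [intervalIntegral.integral_const_mul, h1, norm_mul, norm_mul, norm_mul, Complex.norm_I,
    Complex.norm_real, Complex.norm_real, Real.norm_of_nonneg hnn,
    Real.norm_of_nonneg Real.pi_pos.le, Complex.norm_ofNat, mul_one] at h2
  have h4 : 2 * Real.pi * hermiteSq x n ≤ 2 * Real.pi * (A * (67 / 50)) := by
    have := mul_le_mul_of_nonneg_left hle hA0
    linarith
  have h5 := le_of_mul_le_mul_left h4 Real.two_pi_pos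
  rw [hA] at h5
  linarith

/-- A Cramér type inequality for Hermite functions. -/
theorem hermiteSq_le (x : ℝ) (n : ℕ) : hermiteSq x n ≤ 67 / 50 * Real.exp (x ^ 2 / 2) := by
  have hc : ContinuousAt (fun r : ℝ => r * r ^ (-(n + 1) : ℤ) * r ^ (-1 / 2 : ℝ) *
      (67 / 50 * Real.exp (x ^ 2 / 2))) 1 :=
    ((continuousAt_id.mul (continuousAt_zpow₀ _ _ (Or.inl one_ne_zero))).mul
      (Real.continuousAt_rpow_const _ _ (Or.inl one_ne_zero))).mul continuousAt_const
  -- Let `r` increase to `1`: all powers of `r` disappear from the bound.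
  have ht := hc.tendsto.mono_left (nhdsWithin_le_nhds (s := Set.Iio 1))
  simp only [one_zpow, Real.one_rpow, one_mul] at ht
  refine ge_of_tendsto ht ?_
  filter_upwards [Ioo_mem_nhdsLT (zero_lt_one' ℝ)] with r hr
  exact hermiteSq_le_of_lt_one x n hr.1 hr.2

/-! ### Assembling the bounds for `U_i` and `Δ_i`. -/

theorem eval_hermiteON_sq (ν : ℕ) (x : ℝ) : (hermiteON ν).eval x ^ 2 = hermiteSq x ν := by
  have h : hermiteON ν = C (√(ν.factorial : ℝ))⁻¹ * hermiteReal ν := rfl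
  rw [h, hermiteSq, eval_mul, eval_C, mul_pow, inv_pow, Real.sq_sqrt (by positivity)]
  ring

theorem gaussMean_hermiteON_mul_self (ν : ℕ) : gaussMean (hermiteON ν * hermiteON ν) = 1 := by
  have h : hermiteON ν = C (√(ν.factorial : ℝ))⁻¹ * hermiteReal ν := rfl
  have hs : √(ν.factorial : ℝ) * √(ν.factorial : ℝ) = ν.factorial :=
    Real.mul_self_sqrt (by positivity)
  rw [h, mul_mul_mul_comm, ← C_mul, gaussMean_C_mul, gaussMean_hermiteReal_mul_self, ← mul_inv, hs]
  exact inv_mul_cancel₀ (by positivity)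

theorem gaussHermiteInterp_hermiteON_of_le {i ν : ℕ} (h : ν ≤ i) :
    gaussHermiteInterp i (fun x => (hermiteON ν).eval x) = hermiteON ν := by
  rw [gaussHermiteInterp_eval, modByMonic_eq_self_iff (hermiteReal_monic _),
    degree_eq_natDegree (hermiteReal_monic _).ne_zero, natDegree_hermiteReal]
  refine lt_of_le_of_lt degree_le_natDegree ?_
  have h1 : (hermiteON ν).natDegree ≤ ν :=
    (natDegree_C_mul_le _ _).trans (natDegree_hermiteReal ν).le
  exact_mod_cast (by omega : (hermiteON ν).natDegree < i + 1)

theorem cramerConst_sq_mul_exp_ge_one : 1 ≤ cramerConst ^ 2 * Real.exp 1 := by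
  have he := Real.exp_one_gt_d9
  norm_num [cramerConst]
  linarith

theorem gaussMean_interp_hermiteON_le {ν : ℕ} (hν : 1 ≤ ν) (i : ℕ) :
    gaussMean (gaussHermiteInterp i (fun x => (hermiteON ν).eval x) *
      gaussHermiteInterp i (fun x => (hermiteON ν).eval x)) ≤
      cramerConst ^ 2 * Real.exp 1 * √(2 * (ν : ℝ) - 1) := by
  have hν' : (1 : ℝ) ≤ ν := by exact_mod_cast hν
  rcases le_or_gt ν i with h | h
  · rw [gaussHermiteInterp_hermiteON_of_le h, gaussMean_hermiteON_mul_self]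
    exact one_le_mul_of_one_le_of_one_le cramerConst_sq_mul_exp_ge_one
      (Real.one_le_sqrt.2 (by linarith))
  · rw [gaussMean_interp_mul_self]
    calc ∑ x ∈ gaussHermiteNodes i, gaussHermiteWeight i x * (hermiteON ν).eval x ^ 2
        ≤ ∑ x ∈ gaussHermiteNodes i,
            gaussHermiteWeight i x * (67 / 50 * Real.exp (x ^ 2 / 2)) := by
          refine Finset.sum_le_sum fun x hx => ?_
          rw [eval_hermiteON_sq]
          exact mul_le_mul_of_nonneg_left (hermiteSq_le x ν) (gaussHermiteWeight_nonneg hx)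
      _ = 67 / 50 * ∑ x ∈ gaussHermiteNodes i,
            gaussHermiteWeight i x * Real.exp (x ^ 2 / 2) := by
          rw [Finset.mul_sum]
          exact Finset.sum_congr rfl fun x _ => by ring
      _ ≤ 67 / 50 * (√(4 * ν - 2) * Real.exp (1 / 2)) := by
          gcongr
          exact sum_gaussHermiteWeight_mul_exp_half_le h
      _ = 67 / 50 * (√2 * Real.exp (1 / 2)) * √(2 * ν - 1) := by
          rw [show (4 * ν - 2 : ℝ) = 2 * (2 * ν - 1) by ring, Real.sqrt_mul (by norm_num)]
          ring
      _ ≤ cramerConst ^ 2 * Real.exp 1 * √(2 * (ν : ℝ) - 1) := by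
          refine mul_le_mul_of_nonneg_right ?_ (Real.sqrt_nonneg _)
          have he : Real.exp 1 = Real.exp (1 / 2) * Real.exp (1 / 2) := by
            rw [← Real.exp_add]
            norm_num
          have he1 := Real.exp_one_gt_d9
          have he0 := Real.exp_pos (1 / 2)
          have hhalf : 1.6487 ≤ Real.exp (1 / 2) := by
            refine (sq_le_sq₀ (by norm_num) he0.le).1 ?_
            rw [sq (Real.exp _), ← he]
            norm_num
            linarith
          have h2 : √2 ≤ 1.41422 := Real.sqrt_le_iff.2 (by norm_num)
          -- Numerically `1.895 < 1.946`.
          have h3 : 67 / 50 * √2 ≤ cramerConst ^ 2 * Real.exp (1 / 2) := by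
            norm_num [cramerConst] at h2 hhalf ⊢
            linarith
          rw [he]
          nlinarith

theorem gaussL2Norm_interp_hermiteON_le {ν : ℕ} (hν : 1 ≤ ν) (i : ℕ) :
    gaussL2Norm (gaussHermiteInterp i (fun x => (hermiteON ν).eval x)) ≤
      ENNReal.ofReal (cramerConst * √(Real.exp 1) * ν) := by
  have hν' : (1 : ℝ) ≤ ν := by exact_mod_cast hν
  have hc : 0 ≤ cramerConst := by norm_num [cramerConst]
  rw [gaussL2Norm_eq]
  refine ENNReal.ofReal_le_ofReal (Real.sqrt_le_iff.2 ⟨by positivity, ?_⟩)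
  refine (gaussMean_interp_hermiteON_le hν i).trans ?_
  rw [mul_pow, mul_pow, Real.sq_sqrt (Real.exp_pos 1).le]
  gcongr
  refine Real.sqrt_le_iff.2 ⟨by positivity, ?_⟩
  nlinarith [sq_nonneg ((ν : ℝ) - 1), sq_nonneg ((ν : ℝ) ^ 2 - 1)]

theorem gaussHermiteDetail_succ (i : ℕ) :
    gaussHermiteDetail (i + 1) = gaussHermiteInterp (i + 1) - gaussHermiteInterp i := rfl

theorem gaussL2Norm_hermiteON (ν : ℕ) : gaussL2Norm (hermiteON ν) = 1 := by
  rw [gaussL2Norm_eq, gaussMean_hermiteON_mul_self]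
  simp

theorem gaussL2Norm_sub_le (p q : ℝ[X]) :
    gaussL2Norm (p - q) ≤ gaussL2Norm p + gaussL2Norm q := by
  rw [gaussL2Norm]
  simp only [eval_sub]
  exact eLpNorm_sub_le p.continuous.aestronglyMeasurable q.continuous.aestronglyMeasurable
    (by norm_num)

theorem mainTheorem8 (K : ℝ) (hK : K = 2 * cramerConst * √(Real.exp 1)) :
    (∀ ν : ℕ, 1 ≤ ν → ∀ i : ℕ,
      gaussL2Norm (gaussHermiteInterp i (fun ξ => (hermiteON ν).eval ξ)) ^ 2 ≤
        ENNReal.ofReal (cramerConst ^ 2 * Real.exp 1 * √(2 * (ν : ℝ) - 1))) ∧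
    1 < K ∧
    (∀ i ν : ℕ,
      gaussL2Norm (gaussHermiteDetail i (fun ξ => (hermiteON ν).eval ξ)) ≤
        ENNReal.ofReal (1 + K * (ν : ℝ))) := by
  have hc : 0 ≤ cramerConst := by norm_num [cramerConst]
  refine ⟨fun ν hν i => ?_, ?_, fun i ν => ?_⟩
  · rw [gaussL2Norm_eq, ← ENNReal.ofReal_pow (Real.sqrt_nonneg _),
      Real.sq_sqrt (gaussMean_mul_self_nonneg _)]
    exact ENNReal.ofReal_le_ofReal (gaussMean_interp_hermiteON_le hν i)
  · have h1 : 1 ≤ √(Real.exp 1) := Real.one_le_sqrt.2 (Real.one_le_exp zero_le_one)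
    rw [hK, cramerConst]
    linarith
  -- For `ν = 0` the detail is `H_0` if `i = 0` and zero otherwise; only here is the summand `1`
  -- needed.
  · rcases Nat.eq_zero_or_pos ν with rfl | hν
    · rcases i with _ | i
      · rw [gaussHermiteDetail, gaussHermiteInterp_hermiteON_of_le le_rfl, gaussL2Norm_hermiteON]
        simp
      · rw [gaussHermiteDetail_succ, LinearMap.sub_apply,
          gaussHermiteInterp_hermiteON_of_le (Nat.zero_le _),
          gaussHermiteInterp_hermiteON_of_le (Nat.zero_le _), sub_self]
        simp [gaussL2Norm_eq]
    · have hb : 0 ≤ cramerConst * √(Real.exp 1) * ν := by positivity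
      have hKν : K * ν = cramerConst * √(Real.exp 1) * ν + cramerConst * √(Real.exp 1) * ν := by
        rw [hK]
        ring
      rcases i with _ | i
      · rw [gaussHermiteDetail]
        refine (gaussL2Norm_interp_hermiteON_le hν 0).trans (ENNReal.ofReal_le_ofReal ?_)
        linarith
      · rw [gaussHermiteDetail_succ, LinearMap.sub_apply]
        refine (gaussL2Norm_sub_le _ _).trans ((add_le_add (gaussL2Norm_interp_hermiteON_le hν _)
          (gaussL2Norm_interp_hermiteON_le hν _)).trans ?_)
        rw [← ENNReal.ofReal_add hb hb, ← hKν]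
        exact ENNReal.ofReal_le_ofReal (by linarith)
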